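/- All graphs are finite and simple, and $\omega$ denotes the clique number. A hole of a graph is an induced cycle of length at least $4$; a graph is chordal if it has no hole. A hole cover of a graph is a nonempty set of vertices meeting every hole. A vertex $u$ has the NC property if no hole containing $u$ shares two consecutive edges with a hole not containing $u$; a vertex set $C$ has the NC property if each of its vertices has it and every hole contains at most one vertex of $C$. Locally chordalizing by $u$ means joining $u$ to all vertices, other than $u$ itself, that lie on a hole containing $u$; if $C$ is a hole cover with the NC property, $\widehat{G}(C)$ denotes the graph obtained from $G$ by locally chordalizing successively by the vertices of $C$ (in any order). Let $(C_1,\dots,C_k)$ be an ordered partition of a hole cover $C$ of $G$ into nonempty parts. Put $G_0=G_0^*=G-C$ and, for $i=1,\dots,k$, let $G_i$ be the graph with $V(G_i)=V(G_{i-1}^*)\cup C_i$ and $E(G_i)=E(G_{i-1}^*)\cup E\bigl(G-\bigcup_{j=i+1}^k C_j\bigr)$, and let $G_i^*=\widehat{G_i}(C_i)$. The partition is called a local chordalization partition of $C$ if, for every $i=1,\dots,k$, the set $C_i$ is a hole cover of $G_i$ with the NC property and $G_i^*$ is chordal. The non-chordality index $i(G)$ is $0$ if $G$ is chordal; otherwise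 it is the smallest $k$ for which some hole cover of $G$ has a local chordalization partition into $k$ parts. **Theorem.** Let $G$ be a graph. If $G$ is non-chordal, let $(C_1,\dots,C_{i(G)})$ be any local chordalization partition with $i(G)$ parts of any hole cover of $G$, and let $G^*=G_{i(G)}^*$ be the last graph of the corresponding chain; if $G$ is chordal, let $G^*=G$. Then for every induced subgraph $H$ of $G$, $$\omega(H^*)\le \omega(H)+i(G),$$ where $H^*$ is the subgraph of $G^*$ induced by $V(H)$. Moreover, if $G$ is non-chordal and $n$ is a nonnegative integer such that $G$ has no $K_n$ minor, then $$\omega(G^*)\le n-2+i(G).$$ -/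

import Mathlib

namespace Chordalization

open SimpleGraph

/-- `S` is the vertex set of a hole of `G`, that is, of an induced cycle of length at least four.
As holes are induced subgraphs, a hole is identified with its vertex set, and its edges are the
edges of `G` between vertices of `S`. -/
def IsHole {V : Type*} (G : SimpleGraph V) (S : Set V) : Prop :=
  ∃ n : ℕ, 4 ≤ n ∧ Nonempty (cycleGraph n ≃g G.induce S)

/-- A graph is chordal if it has no hole. -/
def IsChordal {V : Type*} (G : SimpleGraph V) : Prop :=
  ∀ S : Set V, ¬ IsHole G S

/-- A hole cover is a nonempty vertex set that meets every hole. -/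
def IsHoleCover {V : Type*} (G : SimpleGraph V) (X : Set V) : Prop :=
  X.Nonempty ∧ ∀ S : Set V, IsHole G S → (S ∩ X).Nonempty

/-- The holes with vertex sets `S` and `T` share two consecutive edges `ab` and `bc`. -/
def ShareConsecutiveEdges {V : Type*} (G : SimpleGraph V) (S T : Set V) : Prop :=
  ∃ a b c : V, a ≠ c ∧ G.Adj a b ∧ G.Adj b c ∧
    a ∈ S ∧ b ∈ S ∧ c ∈ S ∧ a ∈ T ∧ b ∈ T ∧ c ∈ T

/-- The non-consecutive property of a vertex `u`: a hole containing `u` and a hole not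
containing `u` never share two consecutive edges. -/
def VertexNC {V : Type*} (G : SimpleGraph V) (u : V) : Prop :=
  ∀ S T : Set V, IsHole G S → IsHole G T → u ∈ S → u ∉ T → ¬ ShareConsecutiveEdges G S T

/-- The non-consecutive property of a vertex set `C`: every vertex of `C` has it, and every hole
contains at most one vertex of `C`. -/
def SetNC {V : Type*} (G : SimpleGraph V) (C : Set V) : Prop :=
  (∀ u ∈ C, VertexNC G u) ∧ ∀ S : Set V, IsHole G S → (S ∩ C).Subsingleton

/-- Locally chordalizing all the holes containing `u` by `u`: join `u` to every other vertex
that lies on a hole containing `u`. -/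
def localChordalize {V : Type*} (G : SimpleGraph V) (u : V) : SimpleGraph V :=
  G ⊔ SimpleGraph.fromRel (fun a b => a = u ∧ ∃ S : Set V, IsHole G S ∧ u ∈ S ∧ b ∈ S)

/-- `G'` is obtained from `G` by performing local chordalizations one after another by the
vertices of `C`, each vertex being used once, in some order. When `C` is a hole cover with the
non-consecutive property, the outcome does not depend on the order. -/
def IsSuccessiveLocalChordalization {V : Type*} (G : SimpleGraph V) (C : Set V)
    (G' : SimpleGraph V) : Prop :=
  ∃ l : List V, l.Nodup ∧ (∀ v, v ∈ l ↔ v ∈ C) ∧ G' = l.foldl localChordalize G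

/-- A graph whose vertex set `verts` is a subset of `V`. -/
abbrev GraphIn (V : Type*) := (⊤ : SimpleGraph V).Subgraph

/-- A vertex outside a `GraphIn` lies on no hole of its spanning coercion. So below the holes of
a `GraphIn` are taken as the holes of `spanningCoe`; see also `isHole_coe_iff`. -/
theorem IsHole.subset_verts {V : Type*} {K : GraphIn V} {S : Set V}
    (h : IsHole K.spanningCoe S) : S ⊆ K.verts := by
  obtain ⟨n, hn, ⟨e⟩⟩ := h
  intro v hv
  obtain ⟨m, rfl⟩ : ∃ m, n = m + 2 := ⟨n - 2, by omega⟩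
  have h1 : (cycleGraph (m + 2)).Adj (e.symm ⟨v, hv⟩) (e.symm ⟨v, hv⟩ + 1) := by
    rw [cycleGraph_adj]
    right
    simp
  have h2 := e.map_rel_iff.2 h1
  rw [RelIso.apply_symm_apply] at h2
  exact K.edge_vert h2

theorem isHole_coe_iff {V : Type*} (K : GraphIn V) (S : Set K.verts) :
    IsHole K.coe S ↔ IsHole K.spanningCoe (Subtype.val '' S) := by
  have e : K.coe.induce S ≃g K.spanningCoe.induce (Subtype.val '' S) :=
    { toEquiv := Equiv.Set.image Subtype.val S Subtype.val_injective
      map_rel_iff' := Iff.rfl }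
  exact ⟨fun ⟨n, hn, ⟨f⟩⟩ => ⟨n, hn, ⟨f.trans e⟩⟩, fun ⟨n, hn, ⟨f⟩⟩ => ⟨n, hn, ⟨f.trans e.symm⟩⟩⟩

/-- The chain `A 0 = B 0, A 1, B 1, …, A k, B k` built from the parts `P 0, …, P (k - 1)`:
one starts from `G` minus all the parts; `A (i + 1)` arises from `B i` by adding the vertices of
the part `P i` and all edges of `G` that avoid the later parts; `B (i + 1)` arises from
`A (i + 1)` by local chordalizations by the vertices of `P i`. -/
structure IsChordalizationChain {V : Type*} (G : SimpleGraph V) {k : ℕ} (P : Fin k → Set V)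
    (A B : Fin (k + 1) → GraphIn V) : Prop where
  zero : A 0 = (SimpleGraph.toSubgraph G le_top).deleteVerts (⋃ i, P i)
  zero_star : B 0 = A 0
  step_verts : ∀ i : Fin k, (A i.succ).verts = (B i.castSucc).verts ∪ P i
  step_adj : ∀ (i : Fin k) (a b : V), (A i.succ).Adj a b ↔
    (B i.castSucc).Adj a b ∨ (G.Adj a b ∧ ∀ j, i < j → a ∉ P j ∧ b ∉ P j)
  star_verts : ∀ i : Fin k, (B i.succ).verts = (A i.succ).verts
  star_adj : ∀ i : Fin k,
    IsSuccessiveLocalChordalization (A i.succ).spanningCoe (P i) (B i.succ).spanningCoe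

/-- `P` is an ordered partition of the hole cover `X` of `G` such that, in the corresponding
chain, every part `P i` is a hole cover of `A (i + 1)` with the non-consecutive property, and
every `B (i + 1)` is chordal. -/
def IsLocalChordalizationPartition {V : Type*} (G : SimpleGraph V) (X : Set V) {k : ℕ}
    (P : Fin k → Set V) : Prop :=
  IsHoleCover G X ∧ (∀ i, (P i).Nonempty) ∧ Pairwise (fun i j => Disjoint (P i) (P j)) ∧
    (⋃ i, P i) = X ∧
    ∃ A B : Fin (k + 1) → GraphIn V, IsChordalizationChain G P A B ∧
      ∀ i : Fin k, IsHoleCover (A i.succ).spanningCoe (P i) ∧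
        SetNC (A i.succ).spanningCoe (P i) ∧ IsChordal (B i.succ).spanningCoe

open Classical in
/-- The non-chordality index: zero for a chordal graph, and otherwise the least number of parts
of a local chordalization partition of a hole cover. -/
noncomputable def nonChordalityIndex {V : Type*} (G : SimpleGraph V) : ℕ :=
  if IsChordal G then 0
  else sInf {k : ℕ | ∃ (X : Set V) (P : Fin k → Set V), IsLocalChordalizationPartition G X P}

/-- `H` is a minor of `G`: there are disjoint connected nonempty branch sets in `G`, one for every
vertex of `H`, with an edge of `G` between the branch sets of any two adjacent vertices. -/
def IsMinor {W V : Type*} (H : SimpleGraph W) (G : SimpleGraph V) : Prop :=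
  ∃ D : W → Set V, (∀ w, (G.induce (D w)).Connected) ∧
    Pairwise (fun w w' => Disjoint (D w) (D w')) ∧
    ∀ w w', H.Adj w w' → ∃ a ∈ D w, ∃ b ∈ D w', G.Adj a b

end Chordalization

/-!
Each of the `k` steps of a chordalization chain costs a clique at most one vertex: if `K` is a
clique after the local chordalizations by a part `C`, the new edges inside `K` all meet in one
vertex (`SetNC.isClique_or_exists_isClique_sdiff`), whose removal leaves a clique of the graph
before the step. Going down the chain, at most `k` vertices of a clique of the last graph have to be
removed to obtain a clique of `G`, which is the first bound.

The tool is `VertexNC.exists_isArm`. Let `x` lie on a hole `T` through `u`, and let `Y` be a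
connected set that avoids `u` and does not touch `x`. If `Y` touched both arcs of `T` between `u`
and `x`, a shortest path through the arcs and `Y` would yield a hole through `x` and its two
neighbours on `T` but not through `u`, against the non-consecutive property. So one arc gives a way
from `u` to `x`, an arm, that does not touch `Y`. Two arms that do not touch each other, together
with a path between their ends, close up to a hole through `u`. This shows:
* after the local chordalization by `u` no hole contains `u`, and the remaining holes are those of
  the initial graph that avoid `u`
  (`VertexNC.notMem_of_isHole_localChordalize`, `VertexNC.isHole_localChordalize_iff`). Hence the
  property passes on to the other vertices of `C`, and the order of the vertices is irrelevant. The
  chain is thus determined by the parts (`IsChordalizationChain.unique`), and what is known about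
  one chain holds for each.
* two adjacent vertices of `C` have no common new neighbour (`SetNC.adj_or_adj`). Two disjoint new
  edges inside a clique would then span a hole of length four with two vertices in `C`.

For the second bound, the last vertex `u` to be removed, at the first step of the chain, is joined
to every vertex of the clique of `G` that is left by an edge or by a hole of `G`. Of the two arcs of
such a hole between `u` and a vertex `w` of the clique at most one meets the clique. Contracting the
other arcs into `u` makes `u` adjacent to the whole clique (`isMinor_of_isClique`), so the clique
together with `u` still has fewer than `n` vertices.
-/

namespace Chordalization

open SimpleGraph

variable {V : Type*}

/-! ### Holes as cyclic sequences of vertices -/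

/-- The vertices `f 0, f 1, …, f (n - 1)` are those of `S`, without repetition, and `G` joins two
of them exactly when they are cyclically consecutive. -/
structure IsHoleCycle (G : SimpleGraph V) (S : Set V) (n : ℕ) (f : ℕ → V) : Prop where
  four_le : 4 ≤ n
  inj : ∀ i j, i < n → j < n → f i = f j → i = j
  mem_iff : ∀ v, v ∈ S ↔ ∃ i < n, f i = v
  adj : ∀ i j, i < j → j < n → (G.Adj (f i) (f j) ↔ j = i + 1 ∨ (i = 0 ∧ j + 1 = n))

theorem cycleGraph_adj_of_lt {n : ℕ} (hn : 4 ≤ n) {i j : Fin n} (hij : i < j) :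
    (cycleGraph n).Adj i j ↔ j.val = i.val + 1 ∨ (i.val = 0 ∧ j.val + 1 = n) := by
  have hij' : i.val < j.val := hij
  have hj := j.isLt
  have h1 : (i - j).val = n - j.val + i.val := by
    rw [Fin.sub_def]
    exact Nat.mod_eq_of_lt (by omega)
  have h2 : (j - i).val = j.val - i.val := Fin.sub_val_of_le hij.le
  rw [cycleGraph_adj', h1, h2]
  omega

theorem IsHoleCycle.isHole {G : SimpleGraph V} {S : Set V} {n : ℕ} {f : ℕ → V}
    (h : IsHoleCycle G S n f) : IsHole G S := by
  let g : Fin n → S := fun i => ⟨f i, (h.mem_iff _).2 ⟨i, i.isLt, rfl⟩⟩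
  have hg : Function.Bijective g := by
    constructor
    · intro i j hij
      exact Fin.ext (h.inj _ _ i.isLt j.isLt (congrArg Subtype.val hij))
    · rintro ⟨v, hv⟩
      obtain ⟨i, hi, rfl⟩ := (h.mem_iff v).1 hv
      exact ⟨⟨i, hi⟩, rfl⟩
  refine ⟨n, h.four_le, ⟨⟨Equiv.ofBijective g hg, ?_⟩⟩⟩
  intro i j
  change G.Adj (f i) (f j) ↔ _
  rcases lt_trichotomy i j with hij | rfl | hij
  · rw [cycleGraph_adj_of_lt h.four_le hij, h.adj i j hij j.isLt]
  · simp
  · rw [G.adj_comm, (cycleGraph n).adj_comm, cycleGraph_adj_of_lt h.four_le hij,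
      h.adj j i hij i.isLt]

/-- A hole can be traversed starting from any of its vertices. -/
theorem IsHole.exists_isHoleCycle {G : SimpleGraph V} {S : Set V} (h : IsHole G S) {u : V}
    (hu : u ∈ S) : ∃ n f, IsHoleCycle G S n f ∧ f 0 = u := by
  obtain ⟨n, hn, ⟨e⟩⟩ := h
  have : NeZero n := ⟨by omega⟩
  set s : Fin n := e.symm ⟨u, hu⟩ with hs
  have key : ∀ i j : Fin n, G.Adj (e (s + i)) (e (s + j)) ↔ (cycleGraph n).Adj i j := by
    intro i j
    have h1 : (G.induce S).Adj (e (s + i)) (e (s + j)) ↔ _ := e.map_rel_iff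
    refine h1.trans ?_
    rw [cycleGraph_adj', cycleGraph_adj', add_sub_add_left_eq_sub, add_sub_add_left_eq_sub]
  refine ⟨n, fun i => e (s + Fin.ofNat n i), ⟨hn, ?_, ?_, ?_⟩, ?_⟩
  · intro i j hi hj hij
    have h1 := add_left_cancel (e.injective (Subtype.ext hij))
    have h2 := congrArg Fin.val h1
    simpa [Fin.ofNat, Nat.mod_eq_of_lt hi, Nat.mod_eq_of_lt hj] using h2
  · intro v
    constructor
    · intro hv
      refine ⟨(e.symm ⟨v, hv⟩ - s).val, Fin.isLt _, ?_⟩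
      simp
    · rintro ⟨i, -, rfl⟩
      exact Subtype.coe_prop _
  · intro i j hij hj
    have hi : i < n := hij.trans hj
    have hlt : Fin.ofNat n i < Fin.ofNat n j := by
      rw [Fin.lt_def]
      simpa [Fin.ofNat, Nat.mod_eq_of_lt hi, Nat.mod_eq_of_lt hj] using hij
    rw [key, cycleGraph_adj_of_lt hn hlt]
    simp [Fin.ofNat, Nat.mod_eq_of_lt hi, Nat.mod_eq_of_lt hj]
  · simp [hs]

/-! ### Finding and splitting holes -/

/-- An induced cycle through `u` closes up a shortest path, inside `W`, between two nonadjacent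
neighbours `a`, `b` of `u`, as soon as `u` has no further neighbour in `W`. -/
theorem exists_isHole_of_connected {G : SimpleGraph V} {W : Set V} {u a b : V}
    (hW : (G.induce W).Preconnected) (haW : a ∈ W) (hbW : b ∈ W) (huW : u ∉ W)
    (hua : G.Adj u a) (hub : G.Adj u b) (hab : a ≠ b) (nab : ¬ G.Adj a b)
    (hnbr : ∀ w ∈ W, G.Adj u w → w = a ∨ w = b) :
    ∃ S, IsHole G S ∧ u ∈ S ∧ a ∈ S ∧ b ∈ S ∧ S ⊆ insert u W := by
  set a' : W := ⟨a, haW⟩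
  set b' : W := ⟨b, hbW⟩
  have hr : (G.induce W).Reachable a' b' := hW a' b'
  obtain ⟨p, hp⟩ := hr.exists_walk_length_eq_dist
  have hlen : 1 < p.length := by
    rw [hp]
    exact hr.one_lt_dist_of_ne_of_not_adj (fun h => hab (congrArg Subtype.val h)) nab
  have hpath := p.isPath_of_length_eq_dist hp
  -- along a shortest walk the distance to the start is the position
  have hdist : ∀ i ≤ p.length, (G.induce W).dist a' (p.getVert i) = i := by
    intro i hi
    have h1 : (G.induce W).dist a' (p.getVert i) ≤ i := by
      have := dist_le (p.take i)
      rw [Walk.take_length] at this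
      omega
    have h2 : (G.induce W).dist (p.getVert i) b' ≤ p.length - i := by
      have := dist_le (p.drop i)
      rwa [Walk.drop_length] at this
    have h3 := (p.drop i).reachable.dist_triangle_right a'
    omega
  set m := p.length with hm
  let f : ℕ → V := fun i => if i ≤ m then (p.getVert i : V) else u
  have hf : ∀ i ≤ m, f i = p.getVert i := fun i hi => if_pos hi
  have hfu : f (m + 1) = u := if_neg (by omega)
  have hmem : ∀ i ≤ m, f i ∈ W := fun i hi => by rw [hf i hi]; exact Subtype.coe_prop _
  have h0 : f 0 = a := by rw [hf 0 (Nat.zero_le _)]; simp [a']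
  have hlast : f m = b := by rw [hf m le_rfl, hm]; simp [b']
  have hinj : ∀ i j, i ≤ m → j ≤ m → f i = f j → i = j := by
    intro i j hi hj hij
    rw [hf i hi, hf j hj] at hij
    rw [← hdist i hi, ← hdist j hj, Subtype.ext hij]
  let S : Set V := {v | ∃ i < m + 2, f i = v}
  have hS : IsHoleCycle G S (m + 2) f := by
    refine ⟨by omega, ?_, fun v => Iff.rfl, ?_⟩
    · intro i j hi hj hij
      rcases Nat.lt_or_ge m i with h1 | h1 <;> rcases Nat.lt_or_ge m j with h2 | h2
      · omega
      · obtain rfl : i = m + 1 := by omega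
        exact absurd (hmem j h2) (by rw [← hij, hfu]; exact huW)
      · obtain rfl : j = m + 1 := by omega
        exact absurd (hmem i h1) (by rw [hij, hfu]; exact huW)
      · exact hinj i j h1 h2 hij
    · intro i j hij hj
      rcases Nat.lt_or_ge m j with h2 | h2
      · obtain rfl : j = m + 1 := by omega
        have hi : i ≤ m := by omega
        rw [hfu, G.adj_comm]
        constructor
        · intro hadj
          rcases hnbr _ (hmem i hi) hadj with h | h
          · have := hinj i 0 hi (Nat.zero_le _) (h.trans h0.symm)
            omega
          · have := hinj i m hi le_rfl (h.trans hlast.symm)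
            omega
        · rintro (h | ⟨h, -⟩)
          · obtain rfl : i = m := by omega
            rwa [hlast]
          · rwa [h, h0]
      · have hi : i ≤ m := by omega
        have hadj : G.Adj (f i) (f j) ↔ (G.induce W).Adj (p.getVert i) (p.getVert j) := by
          rw [hf i hi, hf j h2]
          rfl
        rw [hadj]
        constructor
        · intro h
          have h3 := Adj.diff_dist_adj (u := a') h
          rw [hdist i hi, hdist j h2] at h3
          omega
        · rintro (h | ⟨-, h⟩)
          · rw [h]
            exact p.adj_getVert_succ (by omega)
          · omega
  refine ⟨S, hS.isHole, ⟨m + 1, by omega, hfu⟩, ⟨0, by omega, h0⟩, ⟨m, by omega, hlast⟩, ?_⟩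
  rintro v ⟨i, hi, rfl⟩
  rcases Nat.lt_or_ge m i with h1 | h1
  · obtain rfl : i = m + 1 := by omega
    exact Or.inl hfu
  · exact Or.inr (hmem i h1)

theorem induce_connected_of_succ_adj {G : SimpleGraph V} {f : ℕ → V} {a b : ℕ} (hab : a < b)
    (h : ∀ i, a ≤ i → i + 1 < b → G.Adj (f i) (f (i + 1))) :
    (G.induce (f '' Set.Ico a b)).Connected := by
  induction b, hab using Nat.le_induction with
  | base =>
    have : f '' Set.Ico a (a + 1) = {f a, f a} := by
      ext v
      simp only [Set.mem_image, Set.mem_Ico, Set.mem_insert_iff, Set.mem_singleton_iff, or_self]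
      constructor
      · rintro ⟨i, hi, rfl⟩
        rw [show i = a by omega]
      · rintro rfl
        exact ⟨a, by omega, rfl⟩
    rw [Nat.succ_eq_add_one, this, Set.pair_eq_singleton]
    exact Connected.of_subsingleton
  | succ b hb ih =>
    have hb' : a < b := hb
    have h1 : f '' Set.Ico a (b + 1) = f '' Set.Ico a b ∪ {f (b - 1), f b} := by
      ext v
      simp only [Set.mem_image, Set.mem_Ico, Set.mem_union, Set.mem_insert_iff,
        Set.mem_singleton_iff]
      constructor
      · rintro ⟨i, hi, rfl⟩
        by_cases hib : i = b
        · exact Or.inr (Or.inr (by rw [hib]))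
        · exact Or.inl ⟨i, by omega, rfl⟩
      · rintro (⟨i, hi, rfl⟩ | rfl | rfl)
        · exact ⟨i, by omega, rfl⟩
        · exact ⟨b - 1, by omega, rfl⟩
        · exact ⟨b, by omega, rfl⟩
    rw [h1]
    refine induce_union_connected (ih fun i hi hi' => h i hi (by omega)).preconnected
      (induce_pair_connected_of_adj ?_).preconnected ⟨f (b - 1), ⟨b - 1, ?_, rfl⟩, Or.inl rfl⟩
    · have := h (b - 1) (by omega) (by omega)
      rwa [Nat.sub_add_cancel (by omega)] at this
    · simp only [Set.mem_Ico]
      omega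

/-- The vertex sets `A` and `B` meet or are joined by an edge. Subgraphs whose vertex sets do not
touch are disjoint and anticomplete to each other. -/
def Touches (G : SimpleGraph V) (A B : Set V) : Prop :=
  ∃ a ∈ A, ∃ b ∈ B, a = b ∨ G.Adj a b

theorem Touches.symm {G : SimpleGraph V} {A B : Set V} (h : Touches G A B) : Touches G B A := by
  obtain ⟨a, ha, b, hb, rfl | hab⟩ := h
  · exact ⟨a, hb, a, ha, Or.inl rfl⟩
  · exact ⟨b, hb, a, ha, Or.inr hab.symm⟩

theorem Touches.mono {G : SimpleGraph V} {A A' B B' : Set V} (h : Touches G A B) (hA : A ⊆ A')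
    (hB : B ⊆ B') : Touches G A' B' := by
  obtain ⟨a, ha, b, hb, hab⟩ := h
  exact ⟨a, hA ha, b, hB hb, hab⟩

theorem Touches.connected_union {G : SimpleGraph V} {A B : Set V} (h : Touches G A B)
    (hA : (G.induce A).Preconnected) (hB : (G.induce B).Preconnected) :
    (G.induce (A ∪ B)).Connected := by
  obtain ⟨a, ha, b, hb, rfl | hab⟩ := h
  · exact induce_union_connected hA hB ⟨a, ha, hb⟩
  · exact connected_induce_union hA hB ha hb hab

theorem induce_singleton_connected (G : SimpleGraph V) (v : V) :
    (G.induce ({v} : Set V)).Connected :=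
  Connected.of_subsingleton

/-- Removing one vertex from a hole leaves a path, which cannot be split between two sets that
do not touch. -/
theorem IsHole.subset_or_subset {G : SimpleGraph V} {S A B : Set V} {u : V} (hS : IsHole G S)
    (hu : u ∈ S) (hAB : ¬ Touches G A B) (h : S ⊆ insert u (A ∪ B)) :
    S ⊆ insert u A ∨ S ⊆ insert u B := by
  obtain ⟨n, f, hf, h0⟩ := hS.exists_isHoleCycle hu
  have h4 := hf.four_le
  have hmem : ∀ i, 1 ≤ i → i < n → f i ∈ A ∨ f i ∈ B := by
    intro i h1 hi
    rcases h ((hf.mem_iff _).2 ⟨i, hi, rfl⟩) with h2 | h2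
    · have := hf.inj i 0 hi (by omega) (h2.trans h0.symm)
      omega
    · exact h2
  have hstep : ∀ i, 1 ≤ i → i + 1 < n → G.Adj (f i) (f (i + 1)) := fun i _ hi' =>
    (hf.adj i (i + 1) (by omega) hi').2 (Or.inl rfl)
  have hall : ∀ C : Set V, (∀ i, 1 ≤ i → i < n → f i ∈ C) → S ⊆ insert u C := by
    intro C hC v hv
    obtain ⟨i, hi, rfl⟩ := (hf.mem_iff v).1 hv
    rcases Nat.eq_zero_or_pos i with rfl | h1
    · exact Or.inl h0
    · exact Or.inr (hC i h1 hi)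
  rcases hmem 1 le_rfl (by omega) with h1 | h1
  · refine Or.inl (hall A fun i hi => ?_)
    induction i, hi using Nat.le_induction with
    | base => exact fun _ => h1
    | succ i hi ih =>
      intro hi'
      rcases hmem (i + 1) (by omega) hi' with h2 | h2
      · exact h2
      · exact absurd ⟨_, ih (by omega), _, h2, Or.inr (hstep i hi hi')⟩ hAB
  · refine Or.inr (hall B fun i hi => ?_)
    induction i, hi using Nat.le_induction with
    | base => exact fun _ => h1
    | succ i hi ih =>
      intro hi'
      rcases hmem (i + 1) (by omega) hi' with h2 | h2
      · exact absurd ⟨_, h2, _, ih (by omega), Or.inr (hstep i hi hi').symm⟩ hAB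
      · exact h2

/-- `P` is one of the two open arcs into which two nonadjacent vertices `u` and `x` divide the
hole `T`, described by the properties used below: it is connected and contains exactly one
neighbour of `u` and one of `x`. -/
structure IsArc (G : SimpleGraph V) (T : Set V) (u x : V) (P : Set V) : Prop where
  subset : P ⊆ T
  left_notMem : u ∉ P
  right_notMem : x ∉ P
  connected : (G.induce P).Connected
  left_nbr : ∃ a ∈ P, G.Adj u a ∧ ∀ v ∈ P, G.Adj u v → v = a
  right_nbr : ∃ a ∈ P, G.Adj x a ∧ ∀ v ∈ P, G.Adj x v → v = a

theorem IsHole.exists_isArc {G : SimpleGraph V} {T : Set V} {u x : V} (hT : IsHole G T)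
    (hu : u ∈ T) (hx : x ∈ T) (hxu : x ≠ u) (hadj : ¬ G.Adj u x) :
    ∃ P Q, IsArc G T u x P ∧ IsArc G T u x Q ∧ ¬ Touches G P Q := by
  obtain ⟨n, f, hf, h0⟩ := hT.exists_isHoleCycle hu
  have h4 := hf.four_le
  obtain ⟨j, hj, rfl⟩ := (hf.mem_iff x).1 hx
  have hj0 : j ≠ 0 := fun h => hxu (by rw [h, h0])
  rw [← h0, hf.adj 0 j (by omega) hj] at hadj
  push Not at hadj
  have hne : ∀ i k, i < n → k < n → i ≠ k → f i ≠ f k := fun i k hi hk hik h =>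
    hik (hf.inj i k hi hk h)
  have hsub : ∀ a b, b ≤ n → f '' Set.Ico a b ⊆ T := by
    rintro a b hb _ ⟨i, hi, rfl⟩
    exact (hf.mem_iff _).2 ⟨i, lt_of_lt_of_le hi.2 hb, rfl⟩
  have hnot : ∀ a b k, b ≤ n → k < n → (k < a ∨ b ≤ k) → f k ∉ f '' Set.Ico a b := by
    rintro a b k hb hk hab ⟨i, ⟨hi, hi'⟩, h⟩
    have := hf.inj i k (by omega) hk h
    omega
  have hconn : ∀ a b, a < b → b ≤ n → (G.induce (f '' Set.Ico a b)).Connected := fun a b hab hb =>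
    induce_connected_of_succ_adj hab fun i _ hi =>
      (hf.adj i (i + 1) (by omega) (by omega)).2 (Or.inl rfl)
  refine ⟨f '' Set.Ico 1 j, f '' Set.Ico (j + 1) n, ⟨hsub _ _ hj.le, ?_, ?_, ?_, ?_, ?_⟩,
    ⟨hsub _ _ le_rfl, ?_, ?_, ?_, ?_, ?_⟩, ?_⟩
  · rw [← h0]
    exact hnot _ _ _ hj.le (by omega) (by omega)
  · exact hnot _ _ _ hj.le hj (by omega)
  · exact hconn _ _ (by omega) hj.le
  · refine ⟨f 1, ⟨1, ⟨by omega, by omega⟩, rfl⟩, ?_, ?_⟩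
    · rw [← h0, hf.adj 0 1 (by omega) (by omega)]
      omega
    · rintro _ ⟨i, ⟨hi, hi'⟩, rfl⟩ h
      rw [← h0, hf.adj 0 i (by omega) (by omega)] at h
      rw [show i = 1 by omega]
  · refine ⟨f (j - 1), ⟨j - 1, ⟨by omega, by omega⟩, rfl⟩, ?_, ?_⟩
    · rw [G.adj_comm, hf.adj (j - 1) j (by omega) (by omega)]
      omega
    · rintro _ ⟨i, ⟨hi, hi'⟩, rfl⟩ h
      rw [G.adj_comm, hf.adj i j (by omega) (by omega)] at h
      rw [show i = j - 1 by omega]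
  · rw [← h0]
    exact hnot _ _ _ le_rfl (by omega) (by omega)
  · exact hnot _ _ _ le_rfl hj (by omega)
  · exact hconn _ _ (by omega) le_rfl
  · refine ⟨f (n - 1), ⟨n - 1, ⟨by omega, by omega⟩, rfl⟩, ?_, ?_⟩
    · rw [← h0, hf.adj 0 (n - 1) (by omega) (by omega)]
      omega
    · rintro _ ⟨i, ⟨hi, hi'⟩, rfl⟩ h
      rw [← h0, hf.adj 0 i (by omega) (by omega)] at h
      rw [show i = n - 1 by omega]
  · refine ⟨f (j + 1), ⟨j + 1, ⟨by omega, by omega⟩, rfl⟩, ?_, ?_⟩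
    · rw [hf.adj j (j + 1) (by omega) (by omega)]
      omega
    · rintro _ ⟨i, ⟨hi, hi'⟩, rfl⟩ h
      rw [hf.adj j i (by omega) (by omega)] at h
      rw [show i = j + 1 by omega]
  · rintro ⟨_, ⟨i, ⟨hi, hi'⟩, rfl⟩, _, ⟨k, ⟨hk, hk'⟩, rfl⟩, h | h⟩
    · exact hne i k (by omega) (by omega) (by omega) h
    · rw [hf.adj i k (by omega) (by omega)] at h
      omega

/-! ### Arms and local chordalization by one vertex -/

/-- `F` is a connected set that avoids `u`, contains `x`, and contains exactly one neighbour of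
`u`: a way to go from `u` to `x`. -/
structure IsArm (G : SimpleGraph V) (u x : V) (F : Set V) : Prop where
  connected : (G.induce F).Connected
  mem : x ∈ F
  notMem : u ∉ F
  nbr : ∃ a ∈ F, G.Adj u a ∧ ∀ v ∈ F, G.Adj u v → v = a

theorem isArm_singleton {G : SimpleGraph V} {u x : V} (h : G.Adj u x) : IsArm G u x {x} :=
  ⟨induce_singleton_connected G x, rfl, h.ne, x, rfl, h, fun _ hv _ => hv⟩

theorem IsArc.isArm {G : SimpleGraph V} {T P : Set V} {u x : V} (hP : IsArc G T u x P)
    (hxu : x ≠ u) (hadj : ¬ G.Adj u x) : IsArm G u x (P ∪ {x}) := by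
  obtain ⟨a, ha, hua, huniq⟩ := hP.left_nbr
  obtain ⟨b, hb, hxb, -⟩ := hP.right_nbr
  refine ⟨Touches.connected_union ⟨b, hb, x, rfl, Or.inr hxb.symm⟩ hP.connected.preconnected
    (induce_singleton_connected G x).preconnected, Or.inr rfl, ?_, a, Or.inl ha, hua, ?_⟩
  · rintro (h | h)
    · exact hP.left_notMem h
    · exact hxu h.symm
  · rintro v (hv | rfl) huv
    · exact huniq v hv huv
    · exact absurd huv hadj

theorem localChordalize_adj_left {G : SimpleGraph V} {u x : V} :
    (localChordalize G u).Adj u x ↔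
      G.Adj u x ∨ (x ≠ u ∧ ∃ S : Set V, IsHole G S ∧ u ∈ S ∧ x ∈ S) := by
  simp only [localChordalize, sup_adj, fromRel_adj]
  constructor
  · rintro (h | ⟨h, ⟨-, h'⟩ | ⟨h', -⟩⟩)
    · exact Or.inl h
    · exact Or.inr ⟨h.symm, h'⟩
    · exact absurd h'.symm h
  · rintro (h | ⟨h, h'⟩)
    · exact Or.inl h
    · exact Or.inr ⟨h.symm, Or.inl ⟨trivial, h'⟩⟩

theorem localChordalize_adj_of_ne {G : SimpleGraph V} {u a b : V} (ha : a ≠ u) (hb : b ≠ u) :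
    (localChordalize G u).Adj a b ↔ G.Adj a b := by
  simp [localChordalize, ha, hb]

/-- The consequence of the non-consecutive property on which everything rests. If `x` lies on a
hole `T` through `u`, a connected set `Y` avoiding `u` and not touching `x` cannot touch both arcs
of `T` between `u` and `x`: otherwise `x` and its two neighbours on `T` would lie on a hole that
avoids `u`. -/
theorem VertexNC.exists_isArm {G : SimpleGraph V} {u x : V} {Y : Set V} (hnc : VertexNC G u)
    (hux : (localChordalize G u).Adj u x) (hY : (G.induce Y).Preconnected) (huY : u ∉ Y)
    (hxY : ¬ Touches G {x} Y) : ∃ F, IsArm G u x F ∧ ¬ Touches G F Y := by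
  by_cases hadj : G.Adj u x
  · exact ⟨{x}, isArm_singleton hadj, hxY⟩
  obtain ⟨hxu, T, hT, huT, hxT⟩ := (localChordalize_adj_left.1 hux).resolve_left hadj
  obtain ⟨P, Q, hP, hQ, hPQ⟩ := hT.exists_isArc huT hxT hxu hadj
  have htouch : ∀ P : Set V, ¬ Touches G P Y → ¬ Touches G (P ∪ {x}) Y := by
    rintro P hPY ⟨a, ha | ha, h⟩
    · exact hPY ⟨a, ha, h⟩
    · exact hxY ⟨a, ha, h⟩
  by_cases hPY : Touches G P Y
  · by_cases hQY : Touches G Q Y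
    · exfalso
      obtain ⟨p, hp, hxp, hpu⟩ := hP.right_nbr
      obtain ⟨q, hq, hxq, hqu⟩ := hQ.right_nbr
      have hconn : (G.induce (P ∪ Y ∪ Q)).Connected :=
        Touches.connected_union (hQY.symm.mono Set.subset_union_right subset_rfl)
          (hPY.connected_union hP.connected.preconnected hY).preconnected
          hQ.connected.preconnected
      have hpq : p ≠ q := fun h => hPQ ⟨p, hp, q, hq, Or.inl h⟩
      have hxW : x ∉ P ∪ Y ∪ Q := by
        rintro ((h | h) | h)
        · exact hP.right_notMem h
        · exact hxY ⟨x, rfl, x, h, Or.inl rfl⟩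
        · exact hQ.right_notMem h
      have hnbr : ∀ w ∈ P ∪ Y ∪ Q, G.Adj x w → w = p ∨ w = q := by
        rintro w ((h | h) | h) hxw
        · exact Or.inl (hpu w h hxw)
        · exact absurd ⟨x, rfl, w, h, Or.inr hxw⟩ hxY
        · exact Or.inr (hqu w h hxw)
      obtain ⟨S, hS, hxS, hpS, hqS, hSW⟩ := exists_isHole_of_connected hconn.preconnected
        (Or.inl (Or.inl hp)) (Or.inr hq) hxW hxp hxq hpq
        (fun h => hPQ ⟨p, hp, q, hq, Or.inr h⟩) hnbr
      refine hnc T S hT hS huT ?_ ⟨p, x, q, hpq, hxp.symm, hxq, hP.subset hp, hxT, hQ.subset hq,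
          hpS, hxS, hqS⟩
      intro huS
      rcases hSW huS with h | (h | h) | h
      · exact hxu h.symm
      · exact hP.left_notMem h
      · exact huY h
      · exact hQ.left_notMem h
    · exact ⟨Q ∪ {x}, hQ.isArm hxu hadj, htouch Q hQY⟩
  · exact ⟨P ∪ {x}, hP.isArm hxu hadj, htouch P hPY⟩

/-- A hole through `u` after the local chordalization would meet the set of neighbours of `u` in
two vertices only, joined by a path `D` whose vertices lie on no hole of `G` through `u`. Arms from
`u` to the ends of `D` that do not touch each other close `D` up to such a hole. -/
theorem VertexNC.notMem_of_isHole_localChordalize {G : SimpleGraph V} {u : V} {S : Set V}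
    (hnc : VertexNC G u) (hS : IsHole (localChordalize G u) S) : u ∉ S := by
  intro hu
  obtain ⟨n, f, hf, h0⟩ := hS.exists_isHoleCycle hu
  have h4 := hf.four_le
  have hne : ∀ i, 1 ≤ i → i < n → f i ≠ u := by
    intro i h1 hi h
    have := hf.inj i 0 hi (by omega) (h.trans h0.symm)
    omega
  have hadj : ∀ i j, 1 ≤ i → i < j → j < n → (G.Adj (f i) (f j) ↔ j = i + 1) := by
    intro i j h1 hij hj
    rw [← localChordalize_adj_of_ne (hne i h1 (by omega)) (hne j (by omega) hj),
      hf.adj i j hij hj]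
    omega
  have hadj0 : ∀ j, 0 < j → j < n → ((localChordalize G u).Adj u (f j) ↔ j = 1 ∨ j + 1 = n) := by
    intro j hj hjn
    have := hf.adj 0 j hj hjn
    rw [h0] at this
    rw [this]
    omega
  have hnot : ∀ i, 2 ≤ i → i < n - 1 → ¬ (localChordalize G u).Adj u (f i) := by
    intro i hi hi' h
    rw [hadj0 i (by omega) (by omega)] at h
    omega
  have hx : (localChordalize G u).Adj u (f 1) :=
    (hadj0 1 (by omega) (by omega)).2 (by omega)
  have hy : (localChordalize G u).Adj u (f (n - 1)) :=
    (hadj0 (n - 1) (by omega) (by omega)).2 (by omega)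
  have hxy : ¬ Touches G {f (n - 1)} {f 1} := by
    rintro ⟨_, rfl, _, rfl, h | h⟩
    · have := hf.inj _ _ (by omega) (by omega) h
      omega
    · rw [G.adj_comm, hadj 1 (n - 1) le_rfl (by omega) (by omega)] at h
      omega
  obtain ⟨B, hB, hBx⟩ := hnc.exists_isArm hy (induce_singleton_connected G (f 1)).preconnected
    (hne 1 le_rfl (by omega)).symm hxy
  obtain ⟨A, hA, hAB⟩ := hnc.exists_isArm hx hB.connected.preconnected hB.notMem
    (fun h => hBx h.symm)
  set D : Set V := f '' Set.Ico 2 (n - 1) with hD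
  have hDconn : (G.induce D).Connected := induce_connected_of_succ_adj (by omega) fun i hi hi' =>
    (hadj i (i + 1) (by omega) (by omega) (by omega)).2 rfl
  have hDnot : ∀ d ∈ D, ¬ (localChordalize G u).Adj u d := by
    rintro _ ⟨i, hi, rfl⟩
    exact hnot i hi.1 hi.2
  have huD : u ∉ D := by
    rintro ⟨i, hi, h⟩
    exact hne i (by have := hi.1; omega) (by have := hi.2; omega) h
  have hAD : Touches G A D := ⟨f 1, hA.mem, f 2, ⟨2, ⟨le_rfl, by omega⟩, rfl⟩,
    Or.inr ((hadj 1 2 le_rfl (by omega) (by omega)).2 rfl)⟩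
  have hDB : Touches G D B := ⟨f (n - 2), ⟨n - 2, ⟨by omega, by omega⟩, rfl⟩, f (n - 1), hB.mem,
    Or.inr ((hadj (n - 2) (n - 1) (by omega) (by omega) (by omega)).2 (by omega))⟩
  have hconn : (G.induce (A ∪ D ∪ B)).Connected :=
    (hDB.mono Set.subset_union_right subset_rfl).connected_union
      (hAD.connected_union hA.connected.preconnected hDconn.preconnected).preconnected
      hB.connected.preconnected
  obtain ⟨a, ha, hua, hau⟩ := hA.nbr
  obtain ⟨b, hb, hub, hbu⟩ := hB.nbr
  have huW : u ∉ A ∪ D ∪ B := by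
    rintro ((h | h) | h)
    · exact hA.notMem h
    · exact huD h
    · exact hB.notMem h
  have hnbr : ∀ w ∈ A ∪ D ∪ B, G.Adj u w → w = a ∨ w = b := by
    rintro w ((h | h) | h) huw
    · exact Or.inl (hau w h huw)
    · exact absurd (localChordalize_adj_left.2 (Or.inl huw)) (hDnot w h)
    · exact Or.inr (hbu w h huw)
  obtain ⟨R, hR, huR, haR, hbR, hRW⟩ := exists_isHole_of_connected hconn.preconnected
    (Or.inl (Or.inl ha)) (Or.inr hb) huW hua hub
    (fun h => hAB ⟨a, ha, b, hb, Or.inl h⟩) (fun h => hAB ⟨a, ha, b, hb, Or.inr h⟩) hnbr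
  have hRD : ∀ d ∈ R, d ∉ D := fun d hdR hdD => hDnot d hdD
    (localChordalize_adj_left.2 (Or.inr ⟨fun h => huD (h ▸ hdD), R, hR, huR, hdR⟩))
  have hRAB : R ⊆ insert u (A ∪ B) := by
    intro v hv
    rcases hRW hv with h | (h | h) | h
    · exact Or.inl h
    · exact Or.inr (Or.inl h)
    · exact absurd h (hRD v hv)
    · exact Or.inr (Or.inr h)
  rcases hR.subset_or_subset huR hAB hRAB with h | h
  · rcases h hbR with h | h
    · exact hub.ne h.symm
    · exact hAB ⟨b, h, b, hb, Or.inl rfl⟩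
  · rcases h haR with h | h
    · exact hua.ne h.symm
    · exact hAB ⟨a, ha, a, h, Or.inl rfl⟩

/-! ### Local chordalization by a set with the non-consecutive property -/

theorem isHole_congr {G H : SimpleGraph V} {S : Set V}
    (h : ∀ a ∈ S, ∀ b ∈ S, (G.Adj a b ↔ H.Adj a b)) : IsHole G S ↔ IsHole H S := by
  have : G.induce S = H.induce S := by
    ext a b
    exact h a a.2 b b.2
  rw [IsHole, IsHole, this]

theorem VertexNC.isHole_localChordalize_iff {G : SimpleGraph V} {u : V} {S : Set V}
    (hnc : VertexNC G u) : IsHole (localChordalize G u) S ↔ IsHole G S ∧ u ∉ S := by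
  have key : u ∉ S → (IsHole (localChordalize G u) S ↔ IsHole G S) := fun hu =>
    isHole_congr fun a ha b hb =>
      localChordalize_adj_of_ne (fun h => hu (h ▸ ha)) (fun h => hu (h ▸ hb))
  constructor
  · intro hS
    have hu := hnc.notMem_of_isHole_localChordalize hS
    exact ⟨(key hu).1 hS, hu⟩
  · rintro ⟨hS, hu⟩
    exact (key hu).2 hS

theorem SetNC.eq_of_isHole {G : SimpleGraph V} {C S : Set V} {u v : V} (h : SetNC G C)
    (hS : IsHole G S) (hu : u ∈ C) (hv : v ∈ C) (huS : u ∈ S) (hvS : v ∈ S) : u = v :=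
  h.2 S hS ⟨huS, hu⟩ ⟨hvS, hv⟩

theorem SetNC.setNC_localChordalize {G : SimpleGraph V} {C : Set V} {u : V} (h : SetNC G C)
    (hu : u ∈ C) : SetNC (localChordalize G u) C := by
  have hole := fun S => (h.1 u hu).isHole_localChordalize_iff (S := S)
  refine ⟨fun v hv S T hS hT hvS hvT => ?_, fun S hS => h.2 S ((hole S).1 hS).1⟩
  rw [hole] at hS hT
  rintro ⟨a, b, c, hac, hab, hbc, haS, hbS, hcS, haT, hbT, hcT⟩
  have hne : ∀ w ∈ S, w ≠ u := fun w hw h => hS.2 (h ▸ hw)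
  rw [localChordalize_adj_of_ne (hne a haS) (hne b hbS)] at hab
  rw [localChordalize_adj_of_ne (hne b hbS) (hne c hcS)] at hbc
  exact h.1 v hv S T hS.1 hT.1 hvS hvT ⟨a, b, c, hac, hab, hbc, haS, hbS, hcS, haT, hbT, hcT⟩

/-- Successive local chordalizations add exactly the edges that local chordalizations of the
initial graph would add, as the holes left by one of them are those holes of the initial graph that
avoid its vertex. In particular their order is irrelevant. -/
theorem SetNC.foldl_localChordalize_adj_iff {G : SimpleGraph V} {C : Set V} (h : SetNC G C)
    {l : List V} (hl : ∀ v ∈ l, v ∈ C) {a b : V} :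
    (l.foldl localChordalize G).Adj a b ↔
      G.Adj a b ∨ (a ≠ b ∧ ∃ S, IsHole G S ∧ a ∈ S ∧ b ∈ S ∧ (a ∈ l ∨ b ∈ l)) := by
  induction l generalizing G with
  | nil => simp
  | cons u l ih =>
    have hu : u ∈ C := hl u List.mem_cons_self
    have hole := fun S => (h.1 u hu).isHole_localChordalize_iff (S := S)
    rw [List.foldl_cons, ih (h.setNC_localChordalize hu) fun v hv => hl v (List.mem_cons_of_mem _ hv)]
    constructor
    · rintro (h1 | ⟨hab, S, hS, haS, hbS, h1⟩)
      · by_cases ha : a = u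
        · subst ha
          rcases localChordalize_adj_left.1 h1 with h2 | ⟨hba, S, hS, haS, hbS⟩
          · exact Or.inl h2
          · exact Or.inr ⟨hba.symm, S, hS, haS, hbS, Or.inl List.mem_cons_self⟩
        · by_cases hb : b = u
          · subst hb
            rcases localChordalize_adj_left.1 h1.symm with h2 | ⟨hab, S, hS, hbS, haS⟩
            · exact Or.inl h2.symm
            · exact Or.inr ⟨hab, S, hS, haS, hbS, Or.inr List.mem_cons_self⟩
          · exact Or.inl ((localChordalize_adj_of_ne ha hb).1 h1)
      · exact Or.inr ⟨hab, S, ((hole S).1 hS).1, haS, hbS,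
          h1.imp (List.mem_cons_of_mem _) (List.mem_cons_of_mem _)⟩
    · rintro (h1 | ⟨hab, S, hS, haS, hbS, h1⟩)
      · exact Or.inl (le_sup_left (a := G) h1)
      · by_cases ha : a = u
        · subst ha
          exact Or.inl (localChordalize_adj_left.2 (Or.inr ⟨hab.symm, S, hS, haS, hbS⟩))
        by_cases hb : b = u
        · subst hb
          exact Or.inl (localChordalize_adj_left.2 (Or.inr ⟨hab, S, hS, hbS, haS⟩)).symm
        -- the hole `S` has a vertex of `C` other than `u`, so it avoids `u` and persists
        have h2 : a ∈ l ∨ b ∈ l :=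
          h1.imp (fun h => (List.mem_cons.1 h).resolve_left ha)
            (fun h => (List.mem_cons.1 h).resolve_left hb)
        refine Or.inr ⟨hab, S, (hole S).2 ⟨hS, fun huS => ?_⟩, haS, hbS, h2⟩
        rcases h2 with h2 | h2
        · exact ha (h.eq_of_isHole hS (hl a (List.mem_cons_of_mem _ h2)) hu haS huS)
        · exact hb (h.eq_of_isHole hS (hl b (List.mem_cons_of_mem _ h2)) hu hbS huS)

theorem SetNC.adj_iff_of_isSuccessiveLocalChordalization {G G' : SimpleGraph V} {C : Set V}
    (h : SetNC G C) (hG' : IsSuccessiveLocalChordalization G C G') {a b : V} :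
    G'.Adj a b ↔
      G.Adj a b ∨ (a ≠ b ∧ ∃ S, IsHole G S ∧ a ∈ S ∧ b ∈ S ∧ (a ∈ C ∨ b ∈ C)) := by
  obtain ⟨l, -, hl, rfl⟩ := hG'
  rw [h.foldl_localChordalize_adj_iff fun v hv => (hl v).1 hv, hl, hl]

/-! ### Cliques after one step -/

/-- Two adjacent vertices of a set with the non-consecutive property are not both joined to the
same new neighbour: an arm for each of them would give a hole through both. -/
theorem SetNC.adj_or_adj {G : SimpleGraph V} {C T₁ T₂ : Set V} {u₁ u₂ w : V} (h : SetNC G C)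
    (hu₁ : u₁ ∈ C) (hu₂ : u₂ ∈ C) (hadj : G.Adj u₁ u₂) (hT₁ : IsHole G T₁) (hT₂ : IsHole G T₂)
    (huT₁ : u₁ ∈ T₁) (hwT₁ : w ∈ T₁) (huT₂ : u₂ ∈ T₂) (hwT₂ : w ∈ T₂) :
    G.Adj u₁ w ∨ G.Adj u₂ w := by
  by_contra hcon
  push Not at hcon
  obtain ⟨h₁, h₂⟩ := hcon
  have hw₁ : w ≠ u₁ := by
    rintro rfl
    exact hadj.ne (h.eq_of_isHole hT₂ hu₁ hu₂ hwT₂ huT₂)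
  have hw₂ : w ≠ u₂ := by
    rintro rfl
    exact hadj.ne (h.eq_of_isHole hT₁ hu₁ hu₂ huT₁ hwT₁)
  have ht₁ : ¬ Touches G {w} {u₁} := by
    rintro ⟨_, rfl, _, rfl, h | h⟩
    exacts [hw₁ h, h₁ h.symm]
  have ht₂ : ¬ Touches G {w} {u₂} := by
    rintro ⟨_, rfl, _, rfl, h | h⟩
    exacts [hw₂ h, h₂ h.symm]
  obtain ⟨F₁, hF₁, hFu₁⟩ := (h.1 u₁ hu₁).exists_isArm
    (localChordalize_adj_left.2 (Or.inr ⟨hw₁, T₁, hT₁, huT₁, hwT₁⟩))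
    (induce_singleton_connected G u₂).preconnected hadj.ne ht₂
  obtain ⟨F₂, hF₂, hFu₂⟩ := (h.1 u₂ hu₂).exists_isArm
    (localChordalize_adj_left.2 (Or.inr ⟨hw₂, T₂, hT₂, huT₂, hwT₂⟩))
    (induce_singleton_connected G u₁).preconnected hadj.ne.symm ht₁
  obtain ⟨a, ha, hua, hau⟩ := hF₁.nbr
  obtain ⟨b, hb, hub, -⟩ := hF₂.nbr
  have hconn : (G.induce (F₁ ∪ F₂ ∪ {u₂})).Connected :=
    Touches.connected_union ⟨b, Or.inr hb, u₂, rfl, Or.inr hub.symm⟩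
      (induce_union_connected hF₁.connected.preconnected hF₂.connected.preconnected
        ⟨w, hF₁.mem, hF₂.mem⟩).preconnected
      (induce_singleton_connected G u₂).preconnected
  have huW : u₁ ∉ F₁ ∪ F₂ ∪ {u₂} := by
    rintro ((h | h) | h)
    · exact hF₁.notMem h
    · exact hFu₂ ⟨u₁, h, u₁, rfl, Or.inl rfl⟩
    · exact hadj.ne h
  have hnbr : ∀ v ∈ F₁ ∪ F₂ ∪ {u₂}, G.Adj u₁ v → v = a ∨ v = u₂ := by
    rintro v ((h | h) | h) huv
    · exact Or.inl (hau v h huv)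
    · exact absurd ⟨v, h, u₁, rfl, Or.inr huv.symm⟩ hFu₂
    · exact Or.inr h
  obtain ⟨S, hS, h₁S, -, h₂S, -⟩ := exists_isHole_of_connected hconn.preconnected
    (Or.inl (Or.inl ha)) (Or.inr rfl) huW hua hadj
    (fun h => hFu₁ ⟨a, ha, u₂, rfl, Or.inl h⟩) (fun h => hFu₁ ⟨a, ha, u₂, rfl, Or.inr h⟩) hnbr
  exact hadj.ne (h.eq_of_isHole hS hu₁ hu₂ h₁S h₂S)

/-- The new edges inside a clique of the chordalized graph all meet in one vertex. -/
theorem SetNC.isClique_or_exists_isClique_sdiff {G : SimpleGraph V} {C K : Set V} (h : SetNC G C)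
    (hK : K.Pairwise fun a b => G.Adj a b ∨
      ∃ S, IsHole G S ∧ a ∈ S ∧ b ∈ S ∧ (a ∈ C ∨ b ∈ C)) :
    G.IsClique K ∨ ∃ u ∈ K, G.IsClique (K \ {u}) := by
  have key : ∀ u₁ ∈ K, ∀ u₂ ∈ K, ∀ w₁ ∈ K, ∀ w₂ ∈ K, u₁ ∈ C → u₂ ∈ C → u₁ ≠ u₂ → u₁ ≠ w₁ →
      u₂ ≠ w₂ → ¬ G.Adj u₁ w₁ → ¬ G.Adj u₂ w₂ → ∀ T₁ T₂, IsHole G T₁ → IsHole G T₂ →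
      u₁ ∈ T₁ → w₁ ∈ T₁ → u₂ ∈ T₂ → w₂ ∈ T₂ → False := by
    intro u₁ hu₁ u₂ hu₂ w₁ hw₁ w₂ hw₂ hc₁ hc₂ hu hne₁ hne₂ hn₁ hn₂ T₁ T₂ hT₁ hT₂ hut₁ hwt₁ hut₂
      hwt₂
    have hwc₁ : w₁ ∉ C := fun hc => hne₁ (h.eq_of_isHole hT₁ hc₁ hc hut₁ hwt₁)
    have hwc₂ : w₂ ∉ C := fun hc => hne₂ (h.eq_of_isHole hT₂ hc₂ hc hut₂ hwt₂)
    have huu : G.Adj u₁ u₂ := by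
      rcases hK hu₁ hu₂ hu with h1 | ⟨S, hS, h1, h2, -⟩
      · exact h1
      · exact absurd (h.eq_of_isHole hS hc₁ hc₂ h1 h2) hu
    have hw : w₁ ≠ w₂ := by
      rintro rfl
      rcases h.adj_or_adj hc₁ hc₂ huu hT₁ hT₂ hut₁ hwt₁ hut₂ hwt₂ with h1 | h1
      exacts [hn₁ h1, hn₂ h1]
    have hww : G.Adj w₁ w₂ := by
      rcases hK hw₁ hw₂ hw with h1 | ⟨S, hS, -, -, h1 | h1⟩
      exacts [h1, absurd h1 hwc₁, absurd h1 hwc₂]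
    have h₁₂ : G.Adj u₁ w₂ := by
      rcases hK hu₁ hw₂ (fun h => hwc₂ (h ▸ hc₁)) with h1 | ⟨S, hS, h1, h2, -⟩
      · exact h1
      · exact (h.adj_or_adj hc₁ hc₂ huu hS hT₂ h1 h2 hut₂ hwt₂).resolve_right hn₂
    have h₂₁ : G.Adj u₂ w₁ := by
      rcases hK hu₂ hw₁ (fun h => hwc₁ (h ▸ hc₂)) with h1 | ⟨S, hS, h1, h2, -⟩
      · exact h1
      · exact (h.adj_or_adj hc₁ hc₂ huu hT₁ hS hut₁ hwt₁ h1 h2).resolve_left hn₁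
    -- now `u₁ u₂ w₁ w₂` is a hole with two vertices in `C`
    have hconn : (G.induce ({u₂, w₁} ∪ {w₁, w₂})).Connected :=
      induce_union_connected (induce_pair_connected_of_adj h₂₁).preconnected
        (induce_pair_connected_of_adj hww).preconnected ⟨w₁, by simp⟩
    have huW : u₁ ∉ ({u₂, w₁} ∪ {w₁, w₂} : Set V) := by
      rintro ((h | h) | (h | h))
      exacts [hu h, hne₁ h, hne₁ h, h₁₂.ne h]
    have hnbr : ∀ v ∈ ({u₂, w₁} ∪ {w₁, w₂} : Set V), G.Adj u₁ v → v = u₂ ∨ v = w₂ := by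
      rintro v ((rfl | rfl) | (rfl | rfl)) hv
      exacts [Or.inl rfl, absurd hv hn₁, absurd hv hn₁, Or.inr rfl]
    obtain ⟨S, hS, h₁S, h₂S, -, -⟩ := exists_isHole_of_connected hconn.preconnected
      (by simp) (by simp) huW huu h₁₂ hne₂ hn₂ hnbr
    exact hu (h.eq_of_isHole hS hc₁ hc₂ h₁S h₂S)
  have hnew : ∀ a ∈ K, ∀ b ∈ K, a ≠ b → ¬ G.Adj a b → ∃ S, IsHole G S ∧ a ∈ S ∧ b ∈ S ∧
      (a ∈ C ∨ b ∈ C) := fun a ha b hb hab hn => (hK ha hb hab).resolve_left hn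
  have star : ∀ u ∈ K, ∀ w ∈ K, u ≠ w → ¬ G.Adj u w → u ∈ C → ∀ T, IsHole G T → u ∈ T → w ∈ T →
      G.IsClique (K \ {u}) := by
    intro u hu w hw huw hn huC T hT huT hwT a ha b hb hab
    by_contra hn'
    obtain ⟨S, hS, haS, hbS, hC | hC⟩ := hnew a ha.1 b hb.1 hab hn'
    · exact key u hu a ha.1 w hw b hb.1 huC hC (fun h => ha.2 h.symm) huw hab hn hn' T S hT hS
        huT hwT haS hbS
    · exact key u hu b hb.1 w hw a ha.1 huC hC (fun h => hb.2 h.symm) huw hab.symm hn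
        (fun h => hn' h.symm) T S hT hS huT hwT hbS haS
  by_cases hcl : G.IsClique K
  · exact Or.inl hcl
  · right
    simp only [SimpleGraph.IsClique, Set.Pairwise] at hcl
    push Not at hcl
    obtain ⟨a, ha, b, hb, hab, hn⟩ := hcl
    obtain ⟨S, hS, haS, hbS, hC | hC⟩ := hnew a ha b hb hab hn
    · exact ⟨a, ha, star a ha b hb hab hn hC S hS haS hbS⟩
    · exact ⟨b, hb, star b hb a ha hab.symm (fun h => hn h.symm) hC S hS hbS haS⟩

/-! ### Clique minors from holes through one vertex -/

/-- A clique `s` together with a vertex `u` that is joined to each vertex of `s` by an edge or a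
hole gives a clique minor: at most one of the two arcs between `u` and `w ∈ s` of a hole meets `s`,
and contracting the other ones makes `u` adjacent to all of `s`. -/
theorem isMinor_of_isClique {G : SimpleGraph V} {u : V} {s : Finset V} (hus : u ∉ s)
    (hs : G.IsClique (s : Set V)) (hu : ∀ w ∈ s, (localChordalize G u).Adj u w) :
    IsMinor (⊤ : SimpleGraph (Fin (s.card + 1))) G := by
  have hpatch : ∀ w ∈ s, ∃ B : Set V, (G.induce B).Connected ∧ u ∈ B ∧ (∀ v ∈ s, v ∉ B) ∧
      ∃ b ∈ B, G.Adj b w := by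
    intro w hw
    by_cases hadj : G.Adj u w
    · refine ⟨{u}, induce_singleton_connected G u, rfl, ?_, u, rfl, hadj⟩
      rintro v hv rfl
      exact hus hv
    · obtain ⟨hwu, T, hT, huT, hwT⟩ := (localChordalize_adj_left.1 (hu w hw)).resolve_left hadj
      obtain ⟨P, Q, hP, hQ, hPQ⟩ := hT.exists_isArc huT hwT hwu hadj
      have arc : ∀ P, IsArc G T u w P → (∀ v ∈ s, v ∉ P) → ∃ B : Set V, (G.induce B).Connected ∧
          u ∈ B ∧ (∀ v ∈ s, v ∉ B) ∧ ∃ b ∈ B, G.Adj b w := by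
        intro P hP hsP
        obtain ⟨a, ha, hua, -⟩ := hP.left_nbr
        obtain ⟨b, hb, hwb, -⟩ := hP.right_nbr
        refine ⟨P ∪ {u}, Touches.connected_union ⟨a, ha, u, rfl, Or.inr hua.symm⟩
          hP.connected.preconnected (induce_singleton_connected G u).preconnected, Or.inr rfl, ?_,
          b, Or.inl hb, hwb.symm⟩
        rintro v hv (h | rfl)
        exacts [hsP v hv h, hus hv]
      by_cases hsP : ∀ v ∈ s, v ∉ P
      · exact arc P hP hsP
      · refine arc Q hQ fun q hq hqQ => hsP fun p hp hpP => hPQ ⟨p, hpP, q, hqQ, ?_⟩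
        by_cases hpq : p = q
        · exact Or.inl hpq
        · exact Or.inr (hs hp hq hpq)
  choose! B hB using hpatch
  set D : Set V := insert u (⋃ w ∈ s, B w) with hD
  have hBD : ∀ w ∈ s, B w ⊆ D := fun w hw v hv =>
    Or.inr (Set.mem_biUnion (show w ∈ (s : Set V) from hw) hv)
  have hDs : ∀ v ∈ s, v ∉ D := by
    rintro v hv (rfl | h)
    · exact hus hv
    · obtain ⟨w, hw, hvw⟩ := Set.mem_iUnion₂.1 h
      exact (hB w hw).2.2.1 v hv hvw
  have hDconn : (G.induce D).Connected := by
    refine induce_connected_of_patches u (Or.inl rfl) ?_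
    rintro v (rfl | h)
    · exact ⟨{v}, by simp [hD], rfl, rfl, Reachable.refl _⟩
    · obtain ⟨w, hw, hvw⟩ := Set.mem_iUnion₂.1 h
      exact ⟨B w, hBD w hw, (hB w hw).2.1, hvw, (hB w hw).1.preconnected _ _⟩
  let g : Fin s.card → V := fun i => s.equivFin.symm i
  have hgs : ∀ i, g i ∈ s := fun i => Subtype.coe_prop _
  have hg : Function.Injective g := Subtype.val_injective.comp s.equivFin.symm.injective
  have hgD : ∀ i, Disjoint D {g i} := fun i => Set.disjoint_singleton_right.2 (hDs _ (hgs i))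
  have hDg : ∀ i, ∃ a ∈ D, ∃ b ∈ ({g i} : Set V), G.Adj a b := fun i => by
    obtain ⟨b, hb, hadj⟩ := (hB _ (hgs i)).2.2.2
    exact ⟨b, hBD _ (hgs i) hb, g i, rfl, hadj⟩
  refine ⟨Fin.cases D fun i => {g i}, ?_, ?_, ?_⟩
  · intro i
    cases i using Fin.cases with
    | zero => exact hDconn
    | succ i => exact induce_singleton_connected G (g i)
  · intro i j hij
    cases i using Fin.cases with
    | zero =>
      cases j using Fin.cases with
      | zero => exact absurd rfl hij
      | succ j => exact hgD j
    | succ i =>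
      cases j using Fin.cases with
      | zero => exact (hgD i).symm
      | succ j => exact Set.disjoint_singleton.2 fun h => hij (congrArg Fin.succ (hg h))
  · intro i j hij
    cases i using Fin.cases with
    | zero =>
      cases j using Fin.cases with
      | zero => exact absurd hij (by simp)
      | succ j => exact hDg j
    | succ i =>
      cases j using Fin.cases with
      | zero =>
        obtain ⟨a, ha, b, hb, hab⟩ := hDg i
        exact ⟨b, hb, a, ha, hab.symm⟩
      | succ j =>
        exact ⟨g i, rfl, g j, rfl, hs (hgs i) (hgs j) fun h =>
          hij.ne (congrArg Fin.succ (hg h))⟩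

/-! ### The chain of graphs -/

namespace IsChordalizationChain

variable {G : SimpleGraph V} {k : ℕ} {P : Fin k → Set V} {A B : Fin (k + 1) → GraphIn V}

/-- The chain is determined by the parts, since the order of the local chordalizations by the
vertices of a part with the non-consecutive property is irrelevant. -/
theorem unique (h : IsChordalizationChain G P A B) {A' B' : Fin (k + 1) → GraphIn V}
    (h' : IsChordalizationChain G P A' B')
    (hnc : ∀ i : Fin k, SetNC (A i.succ).spanningCoe (P i)) (i : Fin (k + 1)) :
    A i = A' i ∧ B i = B' i := by
  induction i using Fin.induction with
  | zero => rw [h.zero_star, h'.zero_star, h.zero, h'.zero, and_self]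
  | succ i ih =>
    have hA : A i.succ = A' i.succ := by
      ext a b
      · rw [h.step_verts, h'.step_verts, ih.2]
      · rw [h.step_adj, h'.step_adj, ih.2]
    refine ⟨hA, ?_⟩
    have hs' := h'.star_adj i
    rw [← hA] at hs'
    ext a b
    · rw [h.star_verts, h'.star_verts, hA]
    · exact ((hnc i).adj_iff_of_isSuccessiveLocalChordalization (h.star_adj i)).trans
        ((hnc i).adj_iff_of_isSuccessiveLocalChordalization hs').symm

theorem notMem_of_mem_verts (h : IsChordalizationChain G P A B)
    (hP : Pairwise fun i j => Disjoint (P i) (P j)) (i : Fin (k + 1)) {v : V}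
    (hv : v ∈ (B i).verts) (j : Fin k) (hij : i.val ≤ j.val) : v ∉ P j := by
  induction i using Fin.induction with
  | zero =>
    rw [h.zero_star, h.zero, Subgraph.deleteVerts_verts] at hv
    exact fun hvj => hv.2 (Set.mem_iUnion.2 ⟨j, hvj⟩)
  | succ i ih =>
    rw [Fin.val_succ] at hij
    rw [h.star_verts, h.step_verts] at hv
    rcases hv with hv | hv
    · exact ih hv (by rw [Fin.val_castSucc]; omega)
    · have hne : i ≠ j := by
        rintro rfl
        omega
      exact Set.disjoint_left.1 (hP hne) hv

theorem adj_of_adj_zero (h : IsChordalizationChain G P A B) {a b : V} (hab : (B 0).Adj a b) :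
    G.Adj a b := by
  rw [h.zero_star, h.zero, Subgraph.deleteVerts_adj] at hab
  exact hab.2.2.2.2

theorem adj_succ_of_adj (h : IsChordalizationChain G P A B)
    (hP : Pairwise fun i j => Disjoint (P i) (P j)) (i : Fin k) {a b : V}
    (ha : a ∈ (A i.succ).verts) (hb : b ∈ (A i.succ).verts) (hab : G.Adj a b) :
    (A i.succ).Adj a b := by
  rw [← h.star_verts] at ha hb
  refine (h.step_adj i a b).2 (Or.inr ⟨hab, fun j hij => ?_⟩)
  have hij' : i.succ.val ≤ j.val := by
    rw [Fin.val_succ]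
    exact hij
  exact ⟨h.notMem_of_mem_verts hP _ ha j hij', h.notMem_of_mem_verts hP _ hb j hij'⟩

/-- One step down the chain: a set that is a clique up to edges of `G` remains so after the
removal of a single vertex. The edges at this vertex are recorded too, as they give the clique
minor at the first graph of the chain. -/
theorem pairwise_castSucc (h : IsChordalizationChain G P A B)
    (hP : Pairwise fun i j => Disjoint (P i) (P j)) (i : Fin k)
    (hnc : SetNC (A i.succ).spanningCoe (P i)) {K : Set V}
    (hK : K.Pairwise fun a b => G.Adj a b ∨ (B i.succ).Adj a b) :
    (K.Pairwise fun a b => G.Adj a b ∨ (B i.castSucc).Adj a b) ∨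
      ∃ u ∈ K, ((K \ {u}).Pairwise fun a b => G.Adj a b ∨ (B i.castSucc).Adj a b) ∧
        ∀ w ∈ K, w ≠ u → G.Adj u w ∨ (A i.succ).Adj u w ∨
          ∃ S, IsHole (A i.succ).spanningCoe S ∧ u ∈ S ∧ w ∈ S := by
  have hAB : ∀ a b, (A i.succ).Adj a b → (B i.succ).Adj a b := fun a b hab =>
    (hnc.adj_iff_of_isSuccessiveLocalChordalization (h.star_adj i)).2 (Or.inl hab)
  have hBA : ∀ a b, (B i.succ).Adj a b → (A i.succ).spanningCoe.Adj a b ∨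
      ∃ S, IsHole (A i.succ).spanningCoe S ∧ a ∈ S ∧ b ∈ S ∧ (a ∈ P i ∨ b ∈ P i) := fun a b hab =>
    ((hnc.adj_iff_of_isSuccessiveLocalChordalization (h.star_adj i)).1 hab).imp_right And.right
  have hA : ∀ a b, (A i.succ).Adj a b → G.Adj a b ∨ (B i.castSucc).Adj a b := by
    intro a b hab
    rcases (h.step_adj i a b).1 hab with h1 | h1
    exacts [Or.inr h1, Or.inl h1.1]
  -- the part of `K` inside the current graph is a clique of that graph
  set K₀ : Set V := K ∩ (B i.succ).verts with hK₀
  have hK₀B : K₀.Pairwise fun a b => (B i.succ).Adj a b := by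
    intro a ha b hb hab
    rcases hK ha.1 hb.1 hab with h1 | h1
    · refine hAB _ _ (h.adj_succ_of_adj hP i ?_ ?_ h1)
      · rw [← h.star_verts]
        exact ha.2
      · rw [← h.star_verts]
        exact hb.2
    · exact h1
  -- all other pairs of `K` are joined by edges of `G`
  have hout : ∀ L ⊆ K, (A i.succ).spanningCoe.IsClique (L ∩ (B i.succ).verts) →
      L.Pairwise fun a b => G.Adj a b ∨ (B i.castSucc).Adj a b := by
    intro L hL hcl a ha b hb hab
    rcases hK (hL ha) (hL hb) hab with h1 | h1
    · exact Or.inl h1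
    · exact hA _ _ (hcl ⟨ha, (B i.succ).edge_vert h1⟩ ⟨hb, (B i.succ).edge_vert h1.symm⟩ hab)
  rcases hnc.isClique_or_exists_isClique_sdiff (fun a ha b hb hab => hBA a b (hK₀B ha hb hab))
    with h1 | ⟨u, hu, h1⟩
  · exact Or.inl (hout K subset_rfl h1)
  · refine Or.inr ⟨u, hu.1, hout _ Set.sdiff_subset ?_, fun w hw hwu => ?_⟩
    · rwa [Set.sdiff_inter_right_comm]
    · rcases hK hu.1 hw hwu.symm with h2 | h2
      · exact Or.inl h2
      · rcases hBA u w h2 with h3 | ⟨S, hS, h3, h4, -⟩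
        exacts [Or.inr (Or.inl h3), Or.inr (Or.inr ⟨S, hS, h3, h4⟩)]

/-- The graph `A 1` is an induced subgraph of `G`, so its holes are holes of `G`. -/
theorem isHole_of_isHole_first (h : IsChordalizationChain G P A B)
    (hP : Pairwise fun i j => Disjoint (P i) (P j)) (i : Fin k) (hi : i.castSucc = 0) {S : Set V}
    (hS : IsHole (A i.succ).spanningCoe S) : IsHole G S := by
  refine (isHole_congr fun a ha b hb => ⟨fun hab => ?_, fun hab => ?_⟩).1 hS
  · rcases (h.step_adj i a b).1 hab with h1 | h1
    · rw [hi] at h1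
      exact h.adj_of_adj_zero h1
    · exact h1.1
  · exact h.adj_succ_of_adj hP i (hS.subset_verts ha) (hS.subset_verts hb) hab

open Classical in
/-- The induction along the chain. From a clique of the `(i + 1)`-st graph, the removal of at most
`i` vertices leaves a clique of `G`, or one together with a vertex joined to each of its vertices by
an edge or a hole of `G`. -/
theorem exists_sdiff_isClique (h : IsChordalizationChain G P A B)
    (hP : Pairwise fun i j => Disjoint (P i) (P j))
    (hnc : ∀ i : Fin k, SetNC (A i.succ).spanningCoe (P i)) (i : ℕ) (hi : i < k) {K : Finset V}
    (hK : (K : Set V).Pairwise fun a b => G.Adj a b ∨ (B (Fin.succ ⟨i, hi⟩)).Adj a b) :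
    ∃ R ⊆ K, R.card ≤ i ∧ (G.IsClique ((K \ R : Finset V) : Set V) ∨ ∃ u ∈ K \ R,
      G.IsClique (((K \ R).erase u : Finset V) : Set V) ∧
      ∀ w ∈ (K \ R).erase u, (localChordalize G u).Adj u w) := by
  induction i generalizing K with
  | zero =>
    refine ⟨∅, Finset.empty_subset _, le_rfl, ?_⟩
    have h0 : (Fin.castSucc ⟨0, hi⟩ : Fin (k + 1)) = 0 := rfl
    have hG : ∀ a b, (G.Adj a b ∨ (B (Fin.castSucc ⟨0, hi⟩)).Adj a b) → G.Adj a b := by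
      rintro a b (h1 | h1)
      · exact h1
      · rw [h0] at h1
        exact h.adj_of_adj_zero h1
    rw [Finset.sdiff_empty]
    rcases h.pairwise_castSucc hP ⟨0, hi⟩ (hnc _) hK with h1 | ⟨u, hu, h1, h2⟩
    · exact Or.inl fun a ha b hb hab => hG a b (h1 ha hb hab)
    · refine Or.inr ⟨u, hu, ?_, fun w hw => ?_⟩
      · rw [Finset.coe_erase]
        exact fun a ha b hb hab => hG a b (h1 ha hb hab)
      · obtain ⟨hwu, hwK⟩ := Finset.mem_erase.1 hw
        rw [localChordalize_adj_left]
        rcases h2 w hwK hwu with h3 | h3 | ⟨S, hS, h3, h4⟩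
        · exact Or.inl h3
        · rcases (h.step_adj _ u w).1 h3 with h4 | h4
          exacts [Or.inl (hG _ _ (Or.inr h4)), Or.inl h4.1]
        · exact Or.inr ⟨hwu, S, h.isHole_of_isHole_first hP _ h0 hS, h3, h4⟩
  | succ i ih =>
    rcases h.pairwise_castSucc hP ⟨i + 1, hi⟩ (hnc _) hK with h1 | ⟨u, hu, h1, -⟩
    · obtain ⟨R, hR, hcard, hcl⟩ := ih (by omega) h1
      exact ⟨R, hR, by omega, hcl⟩
    · rw [← Finset.coe_erase] at h1
      obtain ⟨R, hR, hcard, hcl⟩ := ih (by omega) h1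
      have hu' : u ∉ R := fun h2 => absurd (hR h2) (Finset.notMem_erase u K)
      have hKR : K \ insert u R = K.erase u \ R := by
        ext v
        simp only [Finset.mem_sdiff, Finset.mem_insert, Finset.mem_erase]
        tauto
      refine ⟨insert u R, ?_, ?_, ?_⟩
      · exact Finset.insert_subset hu (hR.trans (Finset.erase_subset _ _))
      · rw [Finset.card_insert_of_notMem hu']
        omega
      · rw [hKR]
        exact hcl

end IsChordalizationChain

/-! ### Clique numbers -/

theorem exists_isClique_of_cliqueNum_induce (G : SimpleGraph V) (s : Set V) :
    ∃ K : Finset V, (K : Set V) ⊆ s ∧ G.IsClique (K : Set V) ∧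
      K.card = (G.induce s).cliqueNum := by
  obtain ⟨t, ht⟩ := (G.induce s).exists_isNClique_cliqueNum
  refine ⟨t.map (Function.Embedding.subtype _), ?_, ?_, ?_⟩
  · intro v hv
    simp only [Finset.coe_map, Set.mem_image] at hv
    obtain ⟨x, -, rfl⟩ := hv
    exact x.2
  · rintro _ ha _ hb hab
    simp only [Finset.coe_map, Set.mem_image] at ha hb
    obtain ⟨x, hx, rfl⟩ := ha
    obtain ⟨y, hy, rfl⟩ := hb
    exact ht.isClique hx hy fun h => hab (congrArg _ h)
  · rw [Finset.card_map, ht.card_eq]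

theorem card_le_cliqueNum_induce [Finite V] {G : SimpleGraph V} {s : Set V} {K : Finset V}
    (hKs : (K : Set V) ⊆ s) (hK : G.IsClique (K : Set V)) :
    K.card ≤ (G.induce s).cliqueNum := by
  classical
  have : (G.induce s).IsClique ((K.subtype (· ∈ s) : Finset s) : Set s) := by
    intro a ha b hb hab
    exact hK (by simpa using ha) (by simpa using hb) fun h => hab (Subtype.ext h)
  have h2 := this.card_le_cliqueNum
  rwa [Finset.card_subtype, Finset.filter_true_of_mem fun v hv => hKs hv] at h2

end Chordalization

theorem mainTheorem2 {V : Type*} [Finite V] (G Gstar : SimpleGraph V)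
    (hstar : (Chordalization.IsChordal G ∧ Gstar = G) ∨
      ∃ (X : Set V) (P : Fin (Chordalization.nonChordalityIndex G) → Set V)
        (A B : Fin (Chordalization.nonChordalityIndex G + 1) → Chordalization.GraphIn V),
        Chordalization.IsLocalChordalizationPartition G X P ∧
        Chordalization.IsChordalizationChain G P A B ∧
        Gstar = (B (Fin.last (Chordalization.nonChordalityIndex G))).spanningCoe) :
    (∀ s : Set V, (Gstar.induce s).cliqueNum ≤
      (G.induce s).cliqueNum + Chordalization.nonChordalityIndex G) ∧
    (¬ Chordalization.IsChordal G → ∀ n : ℕ,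
      ¬ Chordalization.IsMinor (⊤ : SimpleGraph (Fin n)) G →
        (Gstar.cliqueNum : ℤ) ≤ (n : ℤ) - 2 + (Chordalization.nonChordalityIndex G : ℤ)) := by
  classical
  rcases hstar with ⟨hG, rfl⟩ | ⟨X, P, A, B, ⟨hX, -, hP, hPX, A', B', h', hAB'⟩, h, rfl⟩
  · exact ⟨fun s => Nat.le_add_right _ _, fun hG' => absurd hG hG'⟩
  generalize Chordalization.nonChordalityIndex G = k at *
  have hnc : ∀ i : Fin k, Chordalization.SetNC (A i.succ).spanningCoe (P i) := fun i => by
    rw [← (h'.unique h (fun i => (hAB' i).2.1) i.succ).1]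
    exact (hAB' i).2.1
  obtain ⟨x, hx⟩ := hX.1
  rw [← hPX] at hx
  obtain ⟨i, -⟩ := Set.mem_iUnion.1 hx
  obtain ⟨k, rfl⟩ : ∃ m, k = m + 1 := ⟨k - 1, by have := i.isLt; omega⟩
  have key := fun (K : Finset V) (hK : (B (Fin.last (k + 1))).spanningCoe.IsClique (K : Set V)) =>
    h.exists_sdiff_isClique hP hnc k (Nat.lt_succ_self k) (K := K)
      fun a ha b hb hab => Or.inr (hK ha hb hab)
  constructor
  · intro s
    obtain ⟨K, hKs, hK, hcard⟩ := Chordalization.exists_isClique_of_cliqueNum_induce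
      (B (Fin.last (k + 1))).spanningCoe s
    obtain ⟨R, hR, hRk, hcl⟩ := key K hK
    have h1 := Finset.card_sdiff_add_card_eq_card hR
    have hsub : ((K \ R : Finset V) : Set V) ⊆ s :=
      (Finset.coe_subset.2 Finset.sdiff_subset).trans hKs
    rcases hcl with hcl | ⟨u, hu, hcl, -⟩
    · have h2 := Chordalization.card_le_cliqueNum_induce hsub hcl
      omega
    · have h2 := Chordalization.card_le_cliqueNum_induce
        ((Finset.coe_subset.2 (Finset.erase_subset _ _)).trans hsub) hcl
      have h3 := Finset.card_erase_add_one hu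
      omega
  · intro _ n hn
    by_contra hlt
    obtain ⟨K, hK⟩ := (B (Fin.last (k + 1))).spanningCoe.exists_isNClique_cliqueNum
    obtain ⟨R, hR, hRk, hcl⟩ := key K hK.isClique
    have h1 := Finset.card_sdiff_add_card_eq_card hR
    rw [hK.card_eq] at h1
    have hn0 : n ≠ 0 := by
      rintro rfl
      exact hn ⟨fun i => i.elim0, fun i => i.elim0, fun i => i.elim0, fun i => i.elim0⟩
    have hcard : n ≤ (K \ R).card := by
      push_cast at hlt
      omega
    -- a clique of `G` is treated as the second case, with any of its vertices as `u`
    obtain ⟨u, hu, hcl, hadj⟩ : ∃ u ∈ K \ R,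
        G.IsClique (((K \ R).erase u : Finset V) : Set V) ∧
        ∀ w ∈ (K \ R).erase u, (Chordalization.localChordalize G u).Adj u w := by
      rcases hcl with hcl | hcl
      · obtain ⟨u, hu⟩ := Finset.card_pos.1 (show 0 < (K \ R).card by omega)
        refine ⟨u, hu, hcl.subset (Finset.coe_subset.2 (Finset.erase_subset _ _)), fun w hw => ?_⟩
        obtain ⟨hwu, hw⟩ := Finset.mem_erase.1 hw
        exact Chordalization.localChordalize_adj_left.2 (Or.inl (hcl hu hw hwu.symm))
      · exact hcl
    have h3 := Finset.card_erase_add_one hu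
    obtain ⟨t, ht, htcard⟩ := Finset.exists_subset_card_eq
      (show n - 1 ≤ ((K \ R).erase u).card by omega)
    have hminor := Chordalization.isMinor_of_isClique
      (fun h => Finset.notMem_erase u _ (ht h)) (hcl.subset (Finset.coe_subset.2 ht))
      fun w hw => hadj w (ht hw)
    rw [htcard, Nat.sub_add_cancel (by omega)] at hminor
    exact hn hminor
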